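/- Let $G$ be a finite group and let $H^*(G)=\bigoplus_{n\ge 0}H^n(G,\mathbb{F}_2)$ be its mod $2$ cohomology, with its Steenrod operations $Sq^k$, $k\ge 0$. Let $Q_0=Sq^1$ and $Q_{n+1}=Sq^{2^{n+1}}Q_n+Q_nSq^{2^{n+1}}$ be the Milnor derivations, and let $\tilde{\mathcal{O}}H^*(G)$ denote the set of all elements of the even part $\bigoplus_{m\ge 0}H^{2m}(G,\mathbb{F}_2)$ that are killed by every element of the two-sided ideal generated by $Sq^1$ in the mod $2$ Steenrod algebra. Let $N\ge 0$ be an integer. If the even part of $$\bigcap_{i=0}^N\ker\big(Q_i : H^*(G)\to H^*(G)\big)$$ is stable under all Steenrod operations $Sq^k$, $k \ge 0$, then this even part is equal to $\tilde{\mathcal{O}}H^*(G)$. -/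

import Mathlib

/-!
Mod 2 group cohomology with its Steenrod operations, built from the cup-`i` products on the bar
complex; the mod 2 Steenrod algebra and the Milnor derivations.
-/

namespace GroupSteenrod

/-! ## Cup-`i` products of mod 2 cochains on tuples of vertices

An `n`-cochain is a function on lists of `n + 1` vertices, extended by zero to the other lists. -/

/-- The simplicial coboundary `(δx)(v₀, …, vₙ) = ∑ₖ x(v₀, …, v̂ₖ, …, vₙ)`. -/
def coboundary {V : Type*} : (List V → ZMod 2) → List V → ZMod 2
  | _, [] => 0
  | x, v :: σ => x σ + coboundary (fun τ => x (v :: τ)) σ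

/-- Steenrod's cup-`i` product `x ∪ᵢ y`, for `j = i + 1`:
`(x ∪ᵢ y)(v₀, …, vₙ)` is the sum over all `k₀ < k₁ < … < kᵢ` of
`x(v₀ … v_{k₀}, v_{k₁} … v_{k₂}, v_{k₃} … v_{k₄}, …) * y(v_{k₀} … v_{k₁}, v_{k₂} … v_{k₃}, …)`.
The recursion reads the vertices from the left: either `v` is not one of the `j` cut vertices left
and is given to the current factor, or it is one, and is given to both factors, whose roles are
then exchanged. -/
def cup {V : Type*} : ℕ → (List V → ZMod 2) → (List V → ZMod 2) → List V → ZMod 2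
  | 0, x, y, [] => x [] * y []
  | _ + 1, _, _, [] => 0
  | 0, x, y, v :: σ => cup 0 (fun τ => x (v :: τ)) y σ
  | j + 1, x, y, v :: σ =>
      cup (j + 1) (fun τ => x (v :: τ)) y σ +
        cup j (fun τ => y (v :: τ)) (fun τ => x (v :: τ)) σ

theorem cup_add_left {V : Type*} (j : ℕ) (x x' y : List V → ZMod 2) (l : List V) :
    cup j (fun τ => x τ + x' τ) y l = cup j x y l + cup j x' y l ∧
      cup j y (fun τ => x τ + x' τ) l = cup j y x l + cup j y x' l := by
  induction l generalizing j x x' y with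
  | nil => cases j <;> simp [cup, add_mul, mul_add]
  | cons v σ ih =>
    cases j with
    | zero => simp only [cup]; exact ⟨(ih _ _ _ _).1, (ih _ _ _ _).2⟩
    | succ j =>
      simp only [cup]
      rw [(ih _ _ _ _).1, (ih _ _ _ _).2, (ih _ _ _ _).1, (ih _ _ _ _).2]
      constructor <;> ring

theorem coboundary_add {V : Type*} (x y : List V → ZMod 2) (l : List V) :
    coboundary (fun τ => x τ + y τ) l = coboundary x l + coboundary y l := by
  induction l generalizing x y with
  | nil => simp [coboundary]
  | cons v σ ih => simp only [coboundary]; rw [ih]; ring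

theorem coboundary_cup_zero {V : Type*} (x y : List V → ZMod 2) (l : List V) :
    coboundary (cup 0 x y) l = cup 0 (coboundary x) y l + cup 0 x (coboundary y) l := by
  induction l generalizing x with
  | nil => simp [coboundary, cup]
  | cons v σ ih =>
    simp only [coboundary, cup]
    rw [(cup_add_left _ _ _ _ _).1]
    rw [ih]; ring

theorem coboundary_cup_succ {V : Type*} (j : ℕ) (x y : List V → ZMod 2) (l : List V) :
    coboundary (cup (j + 1) x y) l =
      cup (j + 1) (coboundary x) y l + cup (j + 1) x (coboundary y) l +
        cup j x y l + cup j y x l := by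
  induction l generalizing j x y with
  | nil =>
    cases j
    · simp [coboundary, cup, mul_comm (y []), CharTwo.add_self_eq_zero]
    · simp [coboundary, cup]
  | cons v σ ih =>
    simp only [coboundary, cup]
    rw [coboundary_add, ih, (cup_add_left _ _ _ _ _).1, (cup_add_left _ _ _ _ _).2,
      (cup_add_left _ _ _ _ _).1]
    cases j with
    | zero =>
      rw [coboundary_cup_zero]
      simp only [cup]
      linear_combination (-1 : ZMod 2) * CharTwo.add_self_eq_zero (cup 0 (fun τ => y (v :: τ)) x σ)
    | succ j =>
      rw [ih]
      simp only [cup]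
      linear_combination (-1 : ZMod 2) *
        CharTwo.add_self_eq_zero (cup (j + 1) (fun τ => y (v :: τ)) x σ)

theorem cup_map {V W : Type*} (φ : V → W) (j : ℕ) (x y : List W → ZMod 2) (l : List V) :
    cup j x y (l.map φ) = cup j (fun τ => x (τ.map φ)) (fun τ => y (τ.map φ)) l := by
  induction l generalizing j x y with
  | nil => cases j <;> simp [cup]
  | cons v σ ih => cases j <;> simp [cup, ih]

theorem cup_eq_zero {V : Type*} (l : List V) (a b s t j : ℕ) (x y : List V → ZMod 2)
    (hx : ∀ l, l.length + s ≠ a → x l = 0) (hy : ∀ l, l.length + t ≠ b → y l = 0)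
    (h : l.length + j + s + t ≠ a + b) : cup j x y l = 0 := by
  induction l generalizing j x y s t a b with
  | nil =>
    cases j with
    | zero =>
      simp only [cup]
      simp only [List.length_nil] at h
      by_cases hs : s = a
      · rw [hy [] (by simp only [List.length_nil]; omega), mul_zero]
      · rw [hx [] (by simp only [List.length_nil]; omega), zero_mul]
    | succ j => simp [cup]
  | cons v σ ih =>
    have hx' : ∀ l : List V, l.length + (s + 1) ≠ a → x (v :: l) = 0 := fun l hl =>
      hx _ (by simp only [List.length_cons]; omega)
    have hy' : ∀ l : List V, l.length + (t + 1) ≠ b → y (v :: l) = 0 := fun l hl =>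
      hy _ (by simp only [List.length_cons]; omega)
    simp only [List.length_cons] at h
    cases j with
    | zero => simp only [cup]; exact ih _ _ _ _ _ _ _ hx' hy (by omega)
    | succ j =>
      simp only [cup]
      rw [ih _ _ _ _ _ _ _ hx' hy (by omega), ih _ _ _ _ _ _ _ hy' hx' (by omega), zero_add]

theorem coboundary_ofFn {V : Type*} (n : ℕ) (F : List V → ZMod 2) (v : Fin (n + 1) → V) :
    coboundary F (List.ofFn v) = ∑ k : Fin (n + 1), F (List.ofFn fun i => v (k.succAbove i)) := by
  induction n generalizing F with
  | zero => simp [coboundary]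
  | succ n ih =>
    rw [Fin.sum_univ_succ, List.ofFn_succ, coboundary, ih]
    congr 1
    refine Finset.sum_congr rfl fun k _ => ?_
    rw [List.ofFn_succ]
    simp

/-! ## Transfer to inhomogeneous cochains of a group -/

section
variable {G : Type*} [Group G]

/-- The homogeneous cochain `(v₀, …, vₙ) ↦ f(v₀⁻¹v₁, v₁⁻¹v₂, …, vₙ₋₁⁻¹vₙ)` of an inhomogeneous one,
extended by zero to lists of other lengths. -/
def homogenize (n : ℕ) (f : (Fin n → G) → ZMod 2) (l : List G) : ZMod 2 :=
  if l.length = n + 1 then f fun j => (l.getD j 1)⁻¹ * l.getD (j + 1) 1 else 0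

/-- The inhomogeneous cochain `[g₁|…|gₙ] ↦ F(1, g₁, g₁g₂, …, g₁⋯gₙ)` of a homogeneous one. -/
def restrict (n : ℕ) (F : List G → ZMod 2) (g : Fin n → G) : ZMod 2 :=
  F (List.ofFn (Fin.partialProd g))

theorem homogenize_ofFn (n : ℕ) (f : (Fin n → G) → ZMod 2) (c : G) (g : Fin n → G) :
    homogenize n f (List.ofFn fun i => c * Fin.partialProd g i) = f g := by
  rw [homogenize, if_pos (by simp)]
  congr 1
  funext j
  have h1 : (j : ℕ) < n + 1 := by omega
  have h2 : (j : ℕ) + 1 < n + 1 := by omega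
  simp only [List.getD_eq_getElem?_getD, List.getElem?_ofFn, h1, h2, dif_pos, Option.getD_some]
  rw [mul_inv_rev, mul_assoc, inv_mul_cancel_left]
  exact Fin.partialProd_right_inv g j

theorem exists_ofFn (n : ℕ) (l : List G) (hl : l.length = n + 1) :
    ∃ (c : G) (g : Fin n → G), l = List.ofFn fun i => c * Fin.partialProd g i := by
  obtain ⟨v, rfl⟩ : ∃ v : Fin (n + 1) → G, l = List.ofFn v :=
    ⟨fun i => l[i], by apply List.ext_getElem <;> simp [hl, -List.ofFn_succ]⟩
  refine ⟨v 0, fun i => (v i.castSucc)⁻¹ * v i.succ, ?_⟩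
  congr 1
  exact (Fin.partialProd_left_inv v).symm

theorem homogenize_invariant (n : ℕ) (f : (Fin n → G) → ZMod 2) (c : G) (l : List G) :
    homogenize n f (l.map (c * ·)) = homogenize n f l := by
  by_cases hl : l.length = n + 1
  · obtain ⟨a, g, rfl⟩ := exists_ofFn n l hl
    rw [homogenize_ofFn, List.map_ofFn]
    have := homogenize_ofFn n f (c * a) g
    simpa [Function.comp_def, mul_assoc] using this
  · simp [homogenize, hl]

theorem homogenize_eq_zero (n : ℕ) (f : (Fin n → G) → ZMod 2) (l : List G)
    (h : l.length ≠ n + 1) : homogenize n f l = 0 := if_neg h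

theorem homogenize_restrict (n : ℕ) (F : List G → ZMod 2) (h1 : ∀ c l, F (l.map (c * ·)) = F l)
    (h2 : ∀ l, l.length ≠ n + 1 → F l = 0) : homogenize n (restrict n F) = F := by
  funext l
  by_cases hl : l.length = n + 1
  · obtain ⟨c, g, rfl⟩ := exists_ofFn n l hl
    rw [homogenize_ofFn, restrict, ← h1 c, List.map_ofFn]
    rfl
  · rw [homogenize_eq_zero _ _ _ hl, h2 _ hl]

theorem restrict_homogenize (n : ℕ) (f : (Fin n → G) → ZMod 2) :
    restrict n (homogenize n f) = f := by
  funext g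
  have h := homogenize_ofFn n f 1 g
  simp only [one_mul] at h
  exact h

theorem homogenize_add (n : ℕ) (f f' : (Fin n → G) → ZMod 2) :
    homogenize n (f + f') = fun l => homogenize n f l + homogenize n f' l := by
  funext l
  simp only [homogenize]
  split <;> simp

end

/-! ## Steenrod squares in group cohomology -/

section
variable {G : Type} [Group G]

variable (G) in
/-- The trivial representation of `G` on `𝔽₂`. -/
noncomputable abbrev trivialRep : Rep (ZMod 2) G := Rep.trivial (ZMod 2) G (ZMod 2)

/-- The differential of inhomogeneous cochains with coefficients in `𝔽₂`. -/
noncomputable abbrev cochainD (n : ℕ) (f : (Fin n → G) → ZMod 2) : (Fin (n + 1) → G) → ZMod 2 :=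
  (groupCohomology.inhomogeneousCochains (trivialRep G)).d n (n + 1) f

theorem d_apply (n : ℕ) (f : (Fin n → G) → ZMod 2) (g : Fin (n + 1) → G) :
    cochainD n f g = f (fun i => g i.succ) + ∑ j : Fin (n + 1), f (Fin.contractNth j (· * ·) g) := by
  rw [cochainD, groupCohomology.inhomogeneousCochains.d_def]
  rw [inhomogeneousCochains.d_hom_apply]
  have : (-1 : ZMod 2) = 1 := by decide
  simp [this]

theorem coboundary_homogenize (n : ℕ) (f : (Fin n → G) → ZMod 2) :
    coboundary (homogenize n f) = homogenize (n + 1) (cochainD n f) := by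
  funext l
  by_cases hl : l.length = n + 1 + 1
  · obtain ⟨c, g, rfl⟩ := exists_ofFn (n + 1) l hl
    rw [homogenize_ofFn, coboundary_ofFn, d_apply, Fin.sum_univ_succ]
    congr 1
    · rw [← homogenize_ofFn n f (c * g 0)]
      congr 2
      funext i
      simp only [Fin.zero_succAbove, Fin.partialProd_succ', mul_assoc]
      rfl
    · refine Finset.sum_congr rfl fun j _ => ?_
      rw [← homogenize_ofFn n f c, Fin.partialProd_contractNth]
      rfl
  · rw [homogenize_eq_zero _ _ _ hl]
    cases l with
    | nil => rfl
    | cons a l =>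
      obtain ⟨N, v, hN⟩ : ∃ (N : ℕ) (v : Fin (N + 1) → G), a :: l = List.ofFn v :=
        ⟨l.length, fun i => (a :: l)[i], by apply List.ext_getElem <;> simp [-List.ofFn_succ]⟩
      rw [hN] at hl ⊢
      rw [coboundary_ofFn]
      refine Finset.sum_eq_zero fun k _ => homogenize_eq_zero _ _ _ ?_
      simp only [List.length_ofFn] at hl ⊢
      omega

/-- The cup-`i` product `f ∪ᵢ h` of inhomogeneous cochains, of degree `m = p + q - i`. -/
def cupCochain (i p q m : ℕ) (f : (Fin p → G) → ZMod 2) (h : (Fin q → G) → ZMod 2) :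
    (Fin m → G) → ZMod 2 :=
  restrict m (cup (i + 1) (homogenize p f) (homogenize q h))

theorem homogenize_cupCochain (i p q m : ℕ) (f : (Fin p → G) → ZMod 2) (h : (Fin q → G) → ZMod 2)
    (hm : m + i = p + q) :
    homogenize m (cupCochain i p q m f h) = cup (i + 1) (homogenize p f) (homogenize q h) := by
  refine homogenize_restrict _ _ (fun c l => ?_) fun l hl => ?_
  · rw [cup_map]
    simp only [homogenize_invariant]
  · exact cup_eq_zero l (p + 1) (q + 1) 0 0 _ _ _ (fun l hl => homogenize_eq_zero _ _ _ (by omega))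
      (fun l hl => homogenize_eq_zero _ _ _ (by omega)) (by omega)

theorem homogenize_injective (n : ℕ) : Function.Injective (homogenize (G := G) n) :=
  fun f f' h => by
  rw [← restrict_homogenize n f, h, restrict_homogenize]

theorem cup_zero_homogenize (p q : ℕ) (f : (Fin p → G) → ZMod 2) (h : (Fin q → G) → ZMod 2)
    (l : List G) : cup 0 (homogenize p f) (homogenize q h) l = 0 := by
  have key : ∀ (x y : List G → ZMod 2) (l : List G), y [] = 0 → cup 0 x y l = 0 := by
    intro x y l hy
    induction l generalizing x with
    | nil => simp [cup, hy]
    | cons v σ ih => simp only [cup]; exact ih _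
  exact key _ _ _ (homogenize_eq_zero _ _ _ (by simp))

/-- The cochain `Sq^k f = f ∪ₙ₋ₖ f` of degree `n + k`, for `f` of degree `n` (zero if `k > n`). -/
def sqCochain (k n : ℕ) (f : (Fin n → G) → ZMod 2) : (Fin (n + k) → G) → ZMod 2 :=
  if k ≤ n then cupCochain (n - k) n n (n + k) f f else 0

theorem d_cupCochain_succ (i p q m : ℕ) (f : (Fin p → G) → ZMod 2) (h : (Fin q → G) → ZMod 2)
    (hm : m + (i + 1) = p + q) :
    cochainD m (cupCochain (i + 1) p q m f h) =
      cupCochain (i + 1) (p + 1) q (m + 1) (cochainD p f) h +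
      cupCochain (i + 1) p (q + 1) (m + 1) f (cochainD q h) +
      cupCochain i p q (m + 1) f h + cupCochain i q p (m + 1) h f := by
  apply homogenize_injective
  rw [← coboundary_homogenize, homogenize_cupCochain _ _ _ _ _ _ hm]
  simp only [homogenize_add]
  rw [homogenize_cupCochain _ _ _ _ _ _ (by omega), homogenize_cupCochain _ _ _ _ _ _ (by omega),
    homogenize_cupCochain _ _ _ _ _ _ (by omega), homogenize_cupCochain _ _ _ _ _ _ (by omega)]
  funext l
  rw [coboundary_cup_succ, coboundary_homogenize, coboundary_homogenize]

theorem d_cupCochain_zero (p q m : ℕ) (f : (Fin p → G) → ZMod 2) (h : (Fin q → G) → ZMod 2)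
    (hm : m = p + q) :
    cochainD m (cupCochain 0 p q m f h) = cupCochain 0 (p + 1) q (m + 1) (cochainD p f) h +
      cupCochain 0 p (q + 1) (m + 1) f (cochainD q h) := by
  apply homogenize_injective
  rw [← coboundary_homogenize, homogenize_cupCochain _ _ _ _ _ _ (by omega)]
  simp only [homogenize_add]
  rw [homogenize_cupCochain _ _ _ _ _ _ (by omega), homogenize_cupCochain _ _ _ _ _ _ (by omega)]
  funext l
  rw [coboundary_cup_succ, coboundary_homogenize, coboundary_homogenize,
    cup_zero_homogenize, cup_zero_homogenize]
  ring

theorem cupCochain_zero_left (i p q m : ℕ) (h : (Fin q → G) → ZMod 2) :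
    cupCochain i p q m 0 h = 0 ∧ cupCochain i q p m h 0 = 0 := by
  have h0 : homogenize p (0 : (Fin p → G) → ZMod 2) =
      fun τ => homogenize p 0 τ + homogenize p 0 τ := by
    rw [← homogenize_add, add_zero]
  constructor <;> funext g <;> simp only [cupCochain, restrict, Pi.zero_apply] <;> rw [h0]
  · rw [(cup_add_left _ _ _ _ _).1, CharTwo.add_self_eq_zero]
  · rw [(cup_add_left _ _ _ _ _).2, CharTwo.add_self_eq_zero]

theorem cupCochain_add (i p m : ℕ) (f f' : (Fin p → G) → ZMod 2) :
    cupCochain i p p m (f + f') (f + f') = cupCochain i p p m f f + cupCochain i p p m f' f' +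
      (cupCochain i p p m f f' + cupCochain i p p m f' f) := by
  funext g
  simp only [cupCochain, restrict, homogenize_add, Pi.add_apply]
  rw [(cup_add_left _ _ _ _ _).1, (cup_add_left _ _ _ _ _).2, (cup_add_left _ _ _ _ _).2]
  ring

theorem d_sqCochain (k n : ℕ) (f : (Fin n → G) → ZMod 2) (hf : cochainD n f = 0) :
    cochainD (n + k) (sqCochain k n f) = 0 := by
  have hz : ∀ m, cochainD m (0 : (Fin m → G) → ZMod 2) = 0 := fun m => map_zero _
  rw [sqCochain]
  split_ifs with hk
  · obtain ⟨i, rfl⟩ := Nat.exists_eq_add_of_le hk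
    rw [Nat.add_sub_cancel_left]
    cases i with
    | zero =>
      rw [d_cupCochain_zero _ _ _ _ _ (by omega), hf, (cupCochain_zero_left _ _ _ _ _).1,
        (cupCochain_zero_left _ _ _ _ _).2]
      rfl
    | succ i =>
      rw [d_cupCochain_succ _ _ _ _ _ _ (by omega), hf, (cupCochain_zero_left _ _ _ _ _).1,
        (cupCochain_zero_left _ _ _ _ _).2, add_zero, zero_add]
      funext g
      exact CharTwo.add_self_eq_zero _
  · exact hz _


/-- `f` lies in the image of a differential. -/
def IsCoboundary (n : ℕ) (f : (Fin n → G) → ZMod 2) : Prop :=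
  ∃ (m : ℕ) (w : (Fin m → G) → ZMod 2),
    (groupCohomology.inhomogeneousCochains (trivialRep G)).d m n w = f

theorem isCoboundary_zero (n : ℕ) : IsCoboundary (G := G) n 0 := ⟨n, 0, map_zero _⟩

theorem isCoboundary_dd (n : ℕ) (w : (Fin n → G) → ZMod 2) : IsCoboundary (n + 1) (cochainD n w) :=
  ⟨n, w, rfl⟩

theorem eq_of_isCoboundary {n : ℕ} {f : (Fin n → G) → ZMod 2} (h : IsCoboundary n f) :
    f = 0 ∨ ∃ (m : ℕ) (hm : m + 1 = n) (w : (Fin m → G) → ZMod 2), f = hm ▸ cochainD m w := by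
  obtain ⟨m, w, hw⟩ := h
  by_cases hm : m + 1 = n
  · subst hm
    exact .inr ⟨m, rfl, w, hw.symm⟩
  · left
    rw [(groupCohomology.inhomogeneousCochains (trivialRep G)).shape m n (by simpa using hm)] at hw
    exact hw.symm

theorem d_dd (n : ℕ) (w : (Fin n → G) → ZMod 2) : cochainD (n + 1) (cochainD n w) = 0 := by
  have := (groupCohomology.inhomogeneousCochains (trivialRep G)).d_comp_d n (n + 1) (n + 1 + 1)
  exact congrArg (fun φ => φ.hom w) this

theorem isCoboundary_sqCochain_add (k n : ℕ) (f f' : (Fin n → G) → ZMod 2) (hf : cochainD n f = 0)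
    (hf' : cochainD n f' = 0) :
    IsCoboundary (n + k) (sqCochain k n (f + f') - (sqCochain k n f + sqCochain k n f')) := by
  simp only [sqCochain]
  split_ifs with hk
  · obtain ⟨i, rfl⟩ := Nat.exists_eq_add_of_le hk
    rw [Nat.add_sub_cancel_left, cupCochain_add, add_sub_cancel_left]
    rcases Nat.eq_zero_or_pos (k + i + k) with h0 | h0
    · obtain rfl : k = 0 := by omega
      obtain rfl : i = 0 := by omega
      have h1 : cupCochain 0 (0 + 0) (0 + 0) (0 + 0 + 0) f f' +
          cupCochain 0 (0 + 0) (0 + 0) (0 + 0 + 0) f' f = 0 := by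
        funext g
        simp only [cupCochain, restrict, Pi.add_apply, List.ofFn_succ, List.ofFn_zero, cup, zero_add]
        rw [mul_comm]
        exact CharTwo.add_self_eq_zero _
      rw [h1]
      exact isCoboundary_zero _
    · obtain ⟨m, hm⟩ : ∃ m, k + i + k = m + 1 := ⟨k + i + k - 1, by omega⟩
      have := isCoboundary_dd m (cupCochain (i + 1) (k + i) (k + i) m f f')
      rw [d_cupCochain_succ _ _ _ _ _ _ (by omega), hf, hf', (cupCochain_zero_left _ _ _ _ _).1,
        (cupCochain_zero_left _ _ _ _ _).2, add_zero, zero_add] at this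
      rw [← hm] at this
      exact this
  · simpa using isCoboundary_zero (n + k)

theorem isCoboundary_sqCochain (k n : ℕ) (f : (Fin n → G) → ZMod 2) (hf : IsCoboundary n f) :
    IsCoboundary (n + k) (sqCochain k n f) := by
  rw [sqCochain]
  split_ifs with hk
  · rcases eq_of_isCoboundary hf with rfl | ⟨m, rfl, w, rfl⟩
    · rw [(cupCochain_zero_left _ _ _ _ _).1]
      exact isCoboundary_zero _
    · have h1 := isCoboundary_dd (m + k) (cupCochain (m + 1 - k) m (m + 1) (m + k) w (cochainD m w))
      simp only
      rw [show m + 1 + k = m + k + 1 by omega]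
      cases hi : m + 1 - k with
      | zero =>
        rw [hi, d_cupCochain_zero _ _ _ _ _ (by omega), d_dd,
          (cupCochain_zero_left _ _ _ _ _).2, add_zero] at h1
        exact h1
      | succ j =>
        have h2 : cochainD (m + k) (cupCochain j m m (m + k) w w) =
            cupCochain j m (m + 1) (m + k + 1) w (cochainD m w) +
              cupCochain j (m + 1) m (m + k + 1) (cochainD m w) w := by
          cases j with
          | zero => rw [d_cupCochain_zero _ _ _ _ _ (by omega)]; exact add_comm _ _
          | succ j =>
            rw [d_cupCochain_succ _ _ _ _ _ _ (by omega)]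
            funext g
            simp only [Pi.add_apply]
            linear_combination CharTwo.add_self_eq_zero (cupCochain j m m (m + k + 1) w w g)
        have h3 := isCoboundary_dd (m + k) (cupCochain (j + 1) m (m + 1) (m + k) w (cochainD m w) +
          cupCochain j m m (m + k) w w)
        have h4 : ∀ u v : (Fin (m + k) → G) → ZMod 2, cochainD (m + k) (u + v) =
            cochainD (m + k) u + cochainD (m + k) v := fun u v => map_add _ u v
        rw [h4, h2, d_cupCochain_succ _ _ _ _ _ _ (by omega), d_dd,
          (cupCochain_zero_left _ _ _ _ _).2, add_zero] at h3
        convert h3 using 1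
        funext g
        simp only [Pi.add_apply]
        linear_combination
          (-1 : ZMod 2) * CharTwo.add_self_eq_zero
            (cupCochain j m (m + 1) (m + k + 1) w (cochainD m w) g) +
          (-1 : ZMod 2) * CharTwo.add_self_eq_zero
            (cupCochain j (m + 1) m (m + k + 1) (cochainD m w) w g)
  · exact isCoboundary_zero _


variable (G) in
/-- `Hⁿ(G) = Hⁿ(G, 𝔽₂)`. -/
abbrev H (n : ℕ) : Type := groupCohomology (trivialRep G) n

theorem π_eq_zero_iff (n : ℕ) (z : groupCohomology.cocycles (trivialRep G) n) :
    groupCohomology.π (trivialRep G) n z = 0 ↔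
      IsCoboundary n (groupCohomology.iCocycles (trivialRep G) n z) := by
  set K := groupCohomology.inhomogeneousCochains (trivialRep G)
  have hex : (CategoryTheory.ShortComplex.mk
      (K.toCycles ((ComplexShape.up ℕ).prev n) n) (K.homologyπ n)
      (K.toCycles_comp_homologyπ _ _)).Exact :=
    CategoryTheory.ShortComplex.exact_of_g_is_cokernel _ (K.homologyIsCokernel _ n rfl)
  rw [CategoryTheory.ShortComplex.moduleCat_exact_iff] at hex
  have hinj : Function.Injective (K.iCycles n) :=
    (ModuleCat.mono_iff_injective (K.iCycles n)).1 inferInstance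
  have hcomp : ∀ i (w : K.X i), K.iCycles n (K.toCycles i n w) = K.d i n w := fun i w =>
    congrArg (fun φ => φ.hom w) (K.toCycles_i i n)
  constructor
  · intro hz
    obtain ⟨w, hw⟩ := hex z hz
    refine ⟨_, w, ?_⟩
    rw [← hw]
    exact (hcomp _ w).symm
  · rintro ⟨m, w, hw⟩
    have : z = K.toCycles m n w := hinj (by rw [hcomp]; exact hw.symm)
    rw [this]
    exact congrArg (fun φ => φ.hom w) (K.toCycles_comp_homologyπ m n)

theorem d_iCocycles (n : ℕ) (z : groupCohomology.cocycles (trivialRep G) n) :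
    cochainD n (groupCohomology.iCocycles (trivialRep G) n z) = 0 :=
  congrArg (fun φ => φ.hom z)
    ((groupCohomology.inhomogeneousCochains (trivialRep G)).iCycles_d n (n + 1))

theorem inhom_d_sqCochain (k n : ℕ) (z : groupCohomology.cocycles (trivialRep G) n) :
    inhomogeneousCochains.d (trivialRep G) (n + k)
      (sqCochain k n (groupCohomology.iCocycles (trivialRep G) n z)) = 0 := by
  have := d_sqCochain k n _ (d_iCocycles n z)
  rwa [cochainD, groupCohomology.inhomogeneousCochains.d_def] at this

/-- The cocycle `Sq^k z`. -/
noncomputable def sqCocycle (k n : ℕ) (z : groupCohomology.cocycles (trivialRep G) n) :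
    groupCohomology.cocycles (trivialRep G) (n + k) :=
  groupCohomology.cocyclesMk (sqCochain k n (groupCohomology.iCocycles (trivialRep G) n z))
    (inhom_d_sqCochain k n z)

theorem iCocycles_sqCocycle (k n : ℕ) (z : groupCohomology.cocycles (trivialRep G) n) :
    groupCohomology.iCocycles (trivialRep G) (n + k) (sqCocycle k n z) =
      sqCochain k n (groupCohomology.iCocycles (trivialRep G) n z) :=
  groupCohomology.iCocycles_mk _ (inhom_d_sqCochain k n z)

/-- The class of `Sq^k z`, as an additive function of the cocycle `z`. -/
noncomputable def sqClass (k n : ℕ) : groupCohomology.cocycles (trivialRep G) n →+ H G (n + k) :=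
  AddMonoidHom.mk' (fun z => groupCohomology.π (trivialRep G) (n + k) (sqCocycle k n z)) fun z z' => by
    rw [← sub_eq_zero, ← map_add, ← map_sub, π_eq_zero_iff, map_sub, map_add]
    rw [iCocycles_sqCocycle, iCocycles_sqCocycle, iCocycles_sqCocycle, map_add]
    exact isCoboundary_sqCochain_add k n _ _ (d_iCocycles n z) (d_iCocycles n z')

theorem π_surjective (n : ℕ) :
    Function.Surjective (groupCohomology.π (trivialRep G) n).hom.toAddMonoidHom :=
  (ModuleCat.epi_iff_surjective (groupCohomology.π (trivialRep G) n)).1 <|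
    inferInstanceAs (CategoryTheory.Epi
      ((groupCohomology.inhomogeneousCochains (trivialRep G)).homologyπ n))

theorem ker_le_ker_sqClass (k n : ℕ) :
    (groupCohomology.π (trivialRep G) n).hom.toAddMonoidHom.ker ≤ (sqClass k n).ker := by
  intro z hz
  have hz' : groupCohomology.π (trivialRep G) n z = 0 := hz
  rw [π_eq_zero_iff] at hz'
  change groupCohomology.π (trivialRep G) (n + k) (sqCocycle k n z) = 0
  rw [π_eq_zero_iff, iCocycles_sqCocycle]
  exact isCoboundary_sqCochain k n _ hz'

/-- The Steenrod square `Sq^k : Hⁿ(G) → Hⁿ⁺ᵏ(G)`, sending the class of a cocycle `z` to the class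
of `z ∪ₙ₋ₖ z` (and zero if `k > n`). -/
noncomputable def sq (k n : ℕ) : H G n →ₗ[ZMod 2] H G (n + k) :=
  AddMonoidHom.toZModLinearMap 2 <|
    AddMonoidHom.liftOfSurjective (groupCohomology.π (trivialRep G) n).hom.toAddMonoidHom
      (π_surjective n) ⟨sqClass k n, ker_le_ker_sqClass k n⟩

theorem sq_π (k n : ℕ) (z : groupCohomology.cocycles (trivialRep G) n) :
    sq k n (groupCohomology.π (trivialRep G) n z) =
      groupCohomology.π (trivialRep G) (n + k) (sqCocycle k n z) :=
  AddMonoidHom.liftOfRightInverse_comp_apply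
    (groupCohomology.π (trivialRep G) n).hom.toAddMonoidHom
    (Function.surjInv (π_surjective n)) (Function.rightInverse_surjInv (π_surjective n))
    ⟨sqClass k n, ker_le_ker_sqClass k n⟩ z

variable (G) in
/-- The mod 2 cohomology `H^*(G) = ⨁ₙ Hⁿ(G)`. -/
abbrev HStar : Type := DirectSum ℕ fun n => H G n

variable (G) in
/-- The Steenrod square `Sq^k` on `H^*(G)`. -/
noncomputable def sqTotal (k : ℕ) : Module.End (ZMod 2) (HStar G) :=
  DirectSum.toModule (ZMod 2) ℕ (HStar G) fun n =>
    (DirectSum.lof (ZMod 2) ℕ (fun n => H G n) (n + k)).comp (sq k n)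

end

/-! ## The Steenrod algebra -/

/-- Families of linear endomorphisms of `H^*(G)`, one for each group `G`. -/
abbrev OperationFamily : Type 1 := ∀ G : GrpCat.{0}, Module.End (ZMod 2) (HStar G)

/-- The mod 2 Steenrod algebra, as the algebra of operations on mod 2 cohomology generated by the
Steenrod squares. The Adem relations hold in it, and there are no further relations since the
Steenrod algebra acts faithfully on the cohomology of the elementary abelian 2-groups; so this is
the algebra with generators `Sq^k` and the Adem relations (with `Sq^0 = 1`). -/
noncomputable def steenrodAlgebra : Subalgebra (ZMod 2) OperationFamily :=
  Algebra.adjoin (ZMod 2) (Set.range fun k (G : GrpCat.{0}) => sqTotal G k)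

/-- The element `Sq^k` of the Steenrod algebra. -/
noncomputable def Sq (k : ℕ) : steenrodAlgebra :=
  ⟨fun G => sqTotal G k, Algebra.subset_adjoin ⟨k, rfl⟩⟩

/-- The Milnor derivations `Q₀ = Sq^1`, `Qₙ₊₁ = Sq^(2^(n+1)) Qₙ + Qₙ Sq^(2^(n+1))`. -/
noncomputable def milnorQ : ℕ → steenrodAlgebra
  | 0 => Sq 1
  | n + 1 => Sq (2 ^ (n + 1)) * milnorQ n + milnorQ n * Sq (2 ^ (n + 1))

section
variable (G : Type) [Group G]

/-- The action of the Steenrod algebra on `H^*(G)`. -/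
noncomputable def act : steenrodAlgebra →ₐ[ZMod 2] Module.End (ZMod 2) (HStar G) :=
  (Pi.evalAlgHom (ZMod 2) (fun G : GrpCat.{0} => Module.End (ZMod 2) (HStar G))
    (GrpCat.of G)).comp steenrodAlgebra.val

/-- The even part of `H^*(G)`: the sums of classes of even degree. -/
noncomputable def evenPart : Submodule (ZMod 2) (HStar G) where
  carrier := {x | ∀ n, Odd n → x n = 0}
  zero_mem' _ _ := rfl
  add_mem' hx hy n hn := by rw [DirectSum.add_apply, hx n hn, hy n hn, add_zero]
  smul_mem' c x hx n hn := by rw [DirectSum.smul_apply, hx n hn, smul_zero]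

/-- The intersection of the kernels of `Q₀, …, Q_N` on `H^*(G)`. -/
noncomputable def milnorKernel (N : ℕ) : Submodule (ZMod 2) (HStar G) :=
  ⨅ i ∈ Finset.range (N + 1), LinearMap.ker (act G (milnorQ i))

/-- `ÕH^*(G)`: the classes in the even part of `H^*(G)` that are killed by the two-sided ideal of
the Steenrod algebra generated by `Sq^1`. -/
noncomputable def tildeO : Submodule (ZMod 2) (HStar G) :=
  evenPart G ⊓ ⨅ θ ∈ TwoSidedIdeal.span {Sq 1}, LinearMap.ker (act G θ)

end

end GroupSteenrod

namespace GroupSteenrod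

/-! Let `M` be the even part of the common kernel of `Q₀, …, Q_N`. The equality reduces to two
formal facts about the two-sided ideal `I` generated by `Sq 1`. Every Milnor derivation lies in `I`
(`milnorQ_mem_span`), so a class killed by `I` is killed by all of them; this gives `tildeO G ≤ M`
for every `N`, with no stability assumption. Conversely, stability under the squares makes `M` a
module over the Steenrod algebra (`act_mem_of_stable`), and the annihilator of a module is a
two-sided ideal. Since `Q₀ = Sq 1` annihilates `M`, so does all of `I` (`act_eq_zero_of_mem_span`),
and `M ≤ tildeO G`. Beyond evenness, the second inclusion takes from membership in `M` only the
vanishing of `Q₀`; the higher `Q_i` enter through the stability of `M`. No Adem relation is needed.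
-/

theorem milnorQ_mem_span (n : ℕ) :
    milnorQ n ∈ TwoSidedIdeal.span ({Sq 1} : Set steenrodAlgebra) := by
  induction n with
  | zero => exact TwoSidedIdeal.subset_span rfl
  | succ n ih =>
    -- In the recursion `Qₙ` is the right factor of one summand and the left factor of the other,
    -- which is why the ideal has to be two-sided.
    exact add_mem (TwoSidedIdeal.mul_mem_left _ _ _ ih) (TwoSidedIdeal.mul_mem_right _ _ _ ih)

section
variable {G : Type} [Group G]

theorem mem_milnorKernel {N : ℕ} {x : HStar G} :
    x ∈ milnorKernel G N ↔ ∀ i ≤ N, act G (milnorQ i) x = 0 := by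
  simp [milnorKernel, Submodule.mem_iInf]

theorem mem_tildeO {x : HStar G} :
    x ∈ tildeO G ↔ x ∈ evenPart G ∧
      ∀ θ ∈ TwoSidedIdeal.span ({Sq 1} : Set steenrodAlgebra), act G θ x = 0 := by
  simp [tildeO, Submodule.mem_iInf]

/-- The unconditional inclusion: being killed by the whole ideal is stronger than being killed by
finitely many of its elements. -/
theorem tildeO_le_evenPart_inf_milnorKernel (N : ℕ) :
    tildeO G ≤ evenPart G ⊓ milnorKernel G N := fun _ hx =>
  ⟨hx.1, mem_milnorKernel.2 fun i _ => (mem_tildeO.1 hx).2 _ (milnorQ_mem_span i)⟩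

/-- A subspace of `H^*(G)` that is stable under the Steenrod squares is stable under the whole
Steenrod algebra. -/
theorem act_mem_of_stable {M : Submodule (ZMod 2) (HStar G)}
    (hM : ∀ k, ∀ x ∈ M, act G (Sq k) x ∈ M) (θ : steenrodAlgebra) :
    ∀ x ∈ M, act G θ x ∈ M := by
  obtain ⟨θ, hθ⟩ := θ
  -- An operation is a family indexed by all groups and `act G` evaluates it at `G`. Exposing this
  -- evaluation leaves a statement about a bare family `θ`, suited to induction over the generated
  -- subalgebra.
  change ∀ x ∈ M, θ (GrpCat.of G) x ∈ M
  induction hθ using Algebra.adjoin_induction with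
  | mem θ h =>
    obtain ⟨k, rfl⟩ := h
    exact hM k
  | algebraMap c => exact fun x hx => M.smul_mem c hx
  | add θ η _ _ h h' => exact fun x hx => M.add_mem (h x hx) (h' x hx)
  -- Multiplication of operations is composition, so `η` acts before `θ`.
  | mul θ η _ _ h h' => exact fun x hx => h _ (h' x hx)

/-- If `M` is stable under the Steenrod algebra and killed by `θ₀`, then it is killed by the
two-sided ideal generated by `θ₀`. -/
theorem act_eq_zero_of_mem_span {M : Submodule (ZMod 2) (HStar G)}
    (hM : ∀ k, ∀ x ∈ M, act G (Sq k) x ∈ M) {θ₀ : steenrodAlgebra}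
    (h₀ : ∀ x ∈ M, act G θ₀ x = 0) {θ : steenrodAlgebra}
    (hθ : θ ∈ TwoSidedIdeal.span ({θ₀} : Set steenrodAlgebra)) :
    ∀ x ∈ M, act G θ x = 0 := by
  -- The annihilator of `M`. Closure under left multiplication is automatic, as it would be for the
  -- annihilator of any subset.
  let I : TwoSidedIdeal steenrodAlgebra := .mk' {θ | ∀ x ∈ M, act G θ x = 0}
    (fun x _ => by rw [map_zero, LinearMap.zero_apply])
    (fun h h' x hx => by rw [map_add, LinearMap.add_apply, h x hx, h' x hx, add_zero])
    (fun h x hx => by rw [map_neg, LinearMap.neg_apply, h x hx, neg_zero])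
    (fun h x hx => by rw [map_mul, Module.End.mul_apply, h x hx, map_zero])
    -- Right multiplication is where stability enters: the product first applies `η` to `x`, and the
    -- hypothesis on the left factor only applies if the result is still in `M`.
    (fun {_ η} h x hx => by
      rw [map_mul, Module.End.mul_apply]
      exact h _ (act_mem_of_stable hM η x hx))
  have hI : ∀ {η}, η ∈ I ↔ ∀ x ∈ M, act G η x = 0 := TwoSidedIdeal.mem_mk' ..
  -- The span is the least two-sided ideal containing `θ₀`, hence lies in the annihilator.
  exact hI.1 (TwoSidedIdeal.mem_span_iff.1 hθ I (Set.singleton_subset_iff.2 (hI.2 h₀)))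

end

end GroupSteenrod

theorem mainTheorem5 (G : Type) [Group G] [Finite G] (N : ℕ)
    (hstable : ∀ (k : ℕ), ∀ x ∈ GroupSteenrod.evenPart G ⊓ GroupSteenrod.milnorKernel G N,
      GroupSteenrod.act G (GroupSteenrod.Sq k) x ∈
        GroupSteenrod.evenPart G ⊓ GroupSteenrod.milnorKernel G N) :
    GroupSteenrod.evenPart G ⊓ GroupSteenrod.milnorKernel G N = GroupSteenrod.tildeO G := by
  refine le_antisymm (fun x hx => ?_) (GroupSteenrod.tildeO_le_evenPart_inf_milnorKernel N)
  exact GroupSteenrod.mem_tildeO.2 ⟨hx.1, fun θ hθ =>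
    -- Here `θ₀ = Sq 1`, which is `milnorQ 0` by definition. The index `0` satisfies `0 ≤ N` for
    -- every `N`, so membership in the Milnor kernel already says that `Sq 1` vanishes on `M`.
    GroupSteenrod.act_eq_zero_of_mem_span hstable
      (fun y hy => GroupSteenrod.mem_milnorKernel.1 hy.2 0 N.zero_le) hθ x hx⟩
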